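/- For a finite simple graph $G$ with adjacency matrix $A(G)$ and diagonal degree matrix $D(G)$ let $A_\alpha(G)=\alpha D(G)+(1-\alpha)A(G)$, let $\Delta$ be the largest vertex degree of $G$, and let $\rho(M)$ denote the spectral radius of a square matrix $M$ (the largest modulus of an eigenvalue). A unicyclic graph is a connected graph with exactly one cycle. If $G$ is unicyclic with cycle $C$, deleting the edges of $C$ leaves a forest of trees, each rooted at its vertex on $C$; the height of a rooted tree is the largest distance from its root to a pendant vertex ($0$ for a single vertex), and $k(G)$ is one more than the maximum of the heights of these trees. For real $\gamma,\delta$ let $$Z(\gamma)=\begin{pmatrix}\gamma&\sqrt2&0\\ \sqrt2&0&1\\ 0&1&2\end{pmatrix},\qquad W(\delta)=\begin{pmatrix}\delta&1\\ 1&2\end{pmatrix}.$$ Theorem. There is exactly one $\gamma_0\in(-0.25,-0.2)$ with $\rho(Z(\gamma_0))=2\sqrt2\cos\frac{\pi}{7}$, and exactly one $\delta_0\in(-1.2,-1.1)$ with $\rho(W(\delta_0))=2\sqrt2\cos\frac{\pi}{5}$. Let $G$ be a unicyclic graph with $\Delta=3$ and let $\alpha\in[0,1)$. If $k(G)=3$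 and $\alpha>\frac{-\gamma_0}{2-\gamma_0}$, or if $k(G)=2$ and $\alpha>\frac{-\delta_0}{2-\delta_0}$, then $$\rho(A_\alpha(G))<\alpha\Delta+2(1-\alpha)\sqrt{\Delta-1}\,\cos\frac{\pi}{2k(G)+1}.$$ -/

import Mathlib

open Matrix

noncomputable section

/-- The spectral radius `ρ(M)` of a real square matrix: the largest modulus of its complex
eigenvalues, as a real number. (The spectrum is finite, so the extended value is never `∞`.) -/
def matrixSpectralRadius {n : Type*} [Fintype n] [DecidableEq n] (M : Matrix n n ℝ) : ℝ :=
  (spectralRadius ℂ (M.map (algebraMap ℝ ℂ))).toReal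

/-- The matrix `Z(γ)`. -/
def matrixZ (γ : ℝ) : Matrix (Fin 3) (Fin 3) ℝ :=
  !![γ, √2, 0;
     √2, 0, 1;
     0, 1, 2]

/-- The matrix `W(δ)`. -/
def matrixW (δ : ℝ) : Matrix (Fin 2) (Fin 2) ℝ :=
  !![δ, 1;
     1, 2]

namespace SimpleGraph

/-- `A_α(G) = α D(G) + (1 - α) A(G)`, with `D(G)` the diagonal matrix of the vertex degrees and
`A(G)` the adjacency matrix. -/
def alphaMatrix {V : Type*} [Fintype V] [DecidableEq V] (G : SimpleGraph V)
    [DecidableRel G.Adj] (α : ℝ) : Matrix V V ℝ :=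
  α • G.degMatrix ℝ + (1 - α) • G.adjMatrix ℝ

/-- A subgraph of `G` is a cycle if it consists of the vertices and edges of a closed walk that
visits at least three vertices and repeats none except the starting point. -/
def IsCycleSubgraph {V : Type*} (G : SimpleGraph V) (C : G.Subgraph) : Prop :=
  ∃ (v : V) (p : G.Walk v v), p.IsCycle ∧ p.toSubgraph = C

/-- A unicyclic graph: a connected graph with exactly one cycle. -/
def IsUnicyclic {V : Type*} (G : SimpleGraph V) : Prop :=
  G.Connected ∧ ∃! C : G.Subgraph, G.IsCycleSubgraph C

/-- The height of the tree of the forest `F` that contains the vertex `v`, rooted at `v`: the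
largest distance from the root to a pendant vertex (a vertex with exactly one neighbour) of that
tree. It is `0` for the tree whose only vertex is `v`. -/
def rootedHeight {V : Type*} (F : SimpleGraph V) (v : V) : ℕ :=
  sSup {d : ℕ | ∃ w : V, F.Reachable v w ∧ (∃! u : V, F.Adj w u) ∧ d = F.dist v w}

/-- The height `k(G)` of a unicyclic graph `G`: with `C` its cycle, one more than the largest
height of the trees of the forest `G - E(C)`, each rooted at its vertex on `C`. -/
def unicyclicHeight {V : Type*} (G : SimpleGraph V) : ℕ :=
  sSup {h : ℕ | ∃ C : G.Subgraph, G.IsCycleSubgraph C ∧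
    ∃ v ∈ C.verts, h = (G.deleteEdges C.edgeSet).rootedHeight v} + 1

/-- The inequality `ρ(A_α(G)) < α Δ + 2 (1 - α) √(Δ - 1) cos (π / (2 k(G) + 1))`, where `Δ` is the
largest vertex degree of `G`. -/
def AlphaUpperBound {V : Type*} [Fintype V] [DecidableEq V] (G : SimpleGraph V)
    [DecidableRel G.Adj] (α : ℝ) : Prop :=
  matrixSpectralRadius (G.alphaMatrix α) <
    α * (G.maxDegree : ℝ) + 2 * (1 - α) * √((G.maxDegree : ℝ) - 1) *
      Real.cos (Real.pi / (2 * (G.unicyclicHeight : ℝ) + 1))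

end SimpleGraph

end

/-! Collatz–Wielandt: positive weights `x` whose weighted row sums are all below `c * x` force the
spectral radius below `c`. Weight each vertex by its distance to the cycle. With `t = α / (1 - α)`,
the row inequality at `v` becomes: the neighbour weights sum to less than `(μ + t * (3 - deg v)) * x
v`. A cycle vertex has two neighbours on the cycle and at most one child, an inner tree vertex one
parent and at most two children. A vertex on the last level is pendant and gains `2 * t`. For `k =
3` and weights `1, a, b` this reads `2 + a < μ`, `1 + 2 * b < μ * a`, `a < (μ + 2 * t) * b`. With
equalities and `γ₀` for `-2 * t` it is the eigenvector equation of `Z(γ₀)`, up to diagonal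
rescaling. The condition on `α` says `-2 * t < γ₀`, which makes strict inequality possible. `W(δ₀)`
plays the same role for `k = 2`. The graph input is `IsUnicyclic.exists_level`. -/

section Spectral

/-! ### Spectral radius of real matrices. -/

variable {n : Type*} [Fintype n] [DecidableEq n]

theorem exists_norm_eq_matrixSpectralRadius [Nonempty n] (M : Matrix n n ℝ) :
    (∃ z ∈ spectrum ℂ (M.map (algebraMap ℝ ℂ)), ‖z‖ = matrixSpectralRadius M) ∧
      ∀ z ∈ spectrum ℂ (M.map (algebraMap ℝ ℂ)), ‖z‖ ≤ matrixSpectralRadius M := by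
  let : NormedRing (Matrix n n ℂ) := Matrix.linftyOpNormedRing
  let : NormedAlgebra ℂ (Matrix n n ℂ) := Matrix.linftyOpNormedAlgebra
  obtain ⟨z, hz, h⟩ := spectrum.exists_nnnorm_eq_spectralRadius (M.map (algebraMap ℝ ℂ))
  have h' : ‖z‖ = matrixSpectralRadius M := by
    rw [matrixSpectralRadius, ← h]
    rfl
  refine ⟨⟨z, hz, h'⟩, fun w hw => ?_⟩
  have hle : (‖w‖₊ : ENNReal) ≤ ‖z‖₊ := by
    rw [h]
    exact le_iSup₂ (f := fun (k : ℂ) (_ : k ∈ spectrum ℂ (M.map (algebraMap ℝ ℂ))) =>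
      (‖k‖₊ : ENNReal)) w hw
  rw [← h']
  exact_mod_cast hle

theorem mem_spectrum_iff_det (M : Matrix n n ℝ) (z : ℂ) :
    z ∈ spectrum ℂ (M.map (algebraMap ℝ ℂ)) ↔
      (Matrix.scalar n z - M.map (algebraMap ℝ ℂ)).det = 0 := by
  rw [Matrix.mem_spectrum_iff_isRoot_charpoly, Polynomial.IsRoot, Matrix.eval_charpoly]

/-- The Collatz–Wielandt upper bound for the spectral radius of a nonnegative matrix. -/
theorem matrixSpectralRadius_lt_of_mulVec_lt [Nonempty n] (M : Matrix n n ℝ)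
    (hM : ∀ i j, 0 ≤ M i j) (x : n → ℝ) (hx : ∀ i, 0 < x i) (c : ℝ)
    (h : ∀ i, ∑ j, M i j * x j < c * x i) : matrixSpectralRadius M < c := by
  obtain ⟨z, hz, hr⟩ := (exists_norm_eq_matrixSpectralRadius M).1
  rw [← hr]
  rw [mem_spectrum_iff_det, ← Matrix.exists_mulVec_eq_zero_iff] at hz
  obtain ⟨v, hv, hMv⟩ := hz
  -- The eigenvector equation is compared with `h` at the index where `v` is largest relative to
  -- `x`.
  obtain ⟨i, -, hi⟩ := Finset.exists_max_image Finset.univ (fun i => ‖v i‖ / x i)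
    Finset.univ_nonempty
  obtain ⟨j, hj⟩ := Function.ne_iff.1 hv
  have hvi : 0 < ‖v i‖ / x i :=
    (div_pos (norm_pos_iff.2 hj) (hx j)).trans_le (hi j (Finset.mem_univ j))
  have heq : z * v i = ∑ j, (M i j : ℂ) * v j := by
    have := congrFun hMv i
    rw [Matrix.sub_mulVec] at this
    simpa [Matrix.mulVec, dotProduct, sub_eq_zero, Matrix.diagonal_apply] using this
  have key : ‖z‖ * ‖v i‖ < c * ‖v i‖ := by
    calc ‖z‖ * ‖v i‖ = ‖∑ j, (M i j : ℂ) * v j‖ := by rw [← norm_mul, heq]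
      _ ≤ ∑ j, M i j * ‖v j‖ := by
          refine (norm_sum_le _ _).trans_eq (Finset.sum_congr rfl fun j _ => ?_)
          rw [norm_mul, Complex.norm_real, Real.norm_of_nonneg (hM i j)]
      _ ≤ ∑ j, M i j * (‖v i‖ / x i * x j) := by
          refine Finset.sum_le_sum fun j _ => mul_le_mul_of_nonneg_left ?_ (hM i j)
          exact (div_le_iff₀ (hx j)).1 (hi j (Finset.mem_univ j))
      _ = ‖v i‖ / x i * ∑ j, M i j * x j := by
          rw [Finset.mul_sum]
          exact Finset.sum_congr rfl fun j _ => by ring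
      _ < ‖v i‖ / x i * (c * x i) := mul_lt_mul_of_pos_left (h i) hvi
      _ = c * ‖v i‖ := by
          field_simp [(hx i).ne']
  exact lt_of_mul_lt_mul_right key (norm_nonneg _)

theorem im_eq_zero_of_mem_spectrum (M : Matrix n n ℝ) (hM : M.IsSymm) {z : ℂ}
    (hz : z ∈ spectrum ℂ (M.map (algebraMap ℝ ℂ))) : z.im = 0 := by
  have hH : (M.map (algebraMap ℝ ℂ)).IsHermitian := by
    ext i j
    simp [hM.apply i j]
  rw [hH.spectrum_eq_image_range] at hz
  obtain ⟨r, -, rfl⟩ := hz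
  simp

/-- If the real number `μ` is the spectral radius of a symmetric matrix and `-μ` is not an
eigenvalue, then `μ` is an eigenvalue. -/
theorem det_eq_zero_of_matrixSpectralRadius_eq [Nonempty n] (M : Matrix n n ℝ) (hM : M.IsSymm)
    (μ : ℝ) (h : matrixSpectralRadius M = μ) (hneg : (Matrix.scalar n (-μ) - M).det ≠ 0) :
    (Matrix.scalar n μ - M).det = 0 := by
  obtain ⟨z, hz, hr⟩ := (exists_norm_eq_matrixSpectralRadius M).1
  have him := im_eq_zero_of_mem_spectrum M hM hz
  obtain ⟨r, rfl⟩ : ∃ r : ℝ, z = r := ⟨z.re, Complex.ext (by simp) (by simp [him])⟩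
  rw [mem_spectrum_iff_det] at hz
  have hdet : (Matrix.scalar n r - M).det = 0 := by
    have : (Matrix.scalar n (r : ℂ) - M.map (algebraMap ℝ ℂ)) =
        (algebraMap ℝ ℂ).mapMatrix (Matrix.scalar n r - M) := by
      ext i j
      simp [Matrix.diagonal_apply, apply_ite]
    rw [this, ← RingHom.map_det] at hz
    simpa using hz
  rw [h, Complex.norm_real, Real.norm_eq_abs] at hr
  rcases abs_choice r with h1 | h1
  · rwa [← hr, h1]
  · rw [← hr, h1, neg_neg] at hneg
    exact absurd hdet hneg

theorem matrixSpectralRadius_eq_of_det [Nonempty n] (M : Matrix n n ℝ) (μ : ℝ) (hμ : 0 ≤ μ)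
    (h0 : (Matrix.scalar n (μ : ℂ) - M.map (algebraMap ℝ ℂ)).det = 0)
    (h : ∀ z : ℂ, (Matrix.scalar n z - M.map (algebraMap ℝ ℂ)).det = 0 → ‖z‖ ≤ μ) :
    matrixSpectralRadius M = μ := by
  obtain ⟨⟨z, hz, hr⟩, hle⟩ := exists_norm_eq_matrixSpectralRadius M
  refine le_antisymm (hr ▸ h z ((mem_spectrum_iff_det M z).1 hz)) ?_
  simpa [abs_of_nonneg hμ] using hle μ ((mem_spectrum_iff_det M μ).2 h0)

end Spectral

/-! ### Spectral radii of `Z` and `W`. -/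

theorem det_scalar_sub_matrixZ (γ r : ℝ) :
    (Matrix.scalar (Fin 3) r - matrixZ γ).det =
      (r - γ) * (r * (r - 2) - 1) - 2 * (r - 2) := by
  simp [matrixZ, Matrix.det_fin_three]
  ring

theorem det_scalar_sub_matrixZ_map (γ : ℝ) (z : ℂ) :
    (Matrix.scalar (Fin 3) z - (matrixZ γ).map (algebraMap ℝ ℂ)).det =
      (z - γ) * (z * (z - 2) - 1) - 2 * (z - 2) := by
  have h2 : (√2 : ℂ) * (√2 : ℂ) = 2 := by
    exact_mod_cast Real.mul_self_sqrt (show (0 : ℝ) ≤ 2 by norm_num)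
  simp [matrixZ, Matrix.det_fin_three]
  linear_combination (-(z - 2)) * h2

theorem det_scalar_sub_matrixW (δ r : ℝ) :
    (Matrix.scalar (Fin 2) r - matrixW δ).det = (r - δ) * (r - 2) - 1 := by
  simp [matrixW, Matrix.det_fin_two]

theorem det_scalar_sub_matrixW_map (δ : ℝ) (z : ℂ) :
    (Matrix.scalar (Fin 2) z - (matrixW δ).map (algebraMap ℝ ℂ)).det =
      (z - δ) * (z - 2) - 1 := by
  simp [matrixW, Matrix.det_fin_two]

theorem matrixZ_isSymm (γ : ℝ) : (matrixZ γ).IsSymm := by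
  ext i j
  fin_cases i <;> fin_cases j <;> simp [matrixZ]

theorem matrixW_isSymm (δ : ℝ) : (matrixW δ).IsSymm := by
  ext i j
  fin_cases i <;> fin_cases j <;> simp [matrixW]

theorem matrixSpectralRadius_matrixZ_eq_iff {μ γ : ℝ} (hμ : μ ∈ Set.Ioo (2.5 : ℝ) 2.6)
    (hγ : γ ∈ Set.Ioo (-0.25 : ℝ) (-0.2)) :
    matrixSpectralRadius (matrixZ γ) = μ ↔ (μ - γ) * (μ * (μ - 2) - 1) = 2 * (μ - 2) := by
  obtain ⟨hμ1, hμ2⟩ := hμ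
  obtain ⟨hγ1, hγ2⟩ := hγ
  constructor
  · intro h
    have := det_eq_zero_of_matrixSpectralRadius_eq _ (matrixZ_isSymm γ) μ h (by
      rw [det_scalar_sub_matrixZ]
      nlinarith [mul_pos (show 0 < μ - 2.5 by linarith) (show 0 < μ - 2.5 by linarith),
        mul_pos (show 0 < μ + γ by linarith) (show 0 < μ * (μ + 2) - 1 by nlinarith)])
    rw [det_scalar_sub_matrixZ] at this
    linarith
  · intro h
    refine matrixSpectralRadius_eq_of_det _ μ (by linarith) ?_ fun z hz => ?_
    · rw [det_scalar_sub_matrixZ_map]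
      have : (((μ - γ) * (μ * (μ - 2) - 1) : ℝ) : ℂ) = ((2 * (μ - 2) : ℝ) : ℂ) := by rw [h]
      push_cast at this
      linear_combination this
    · rw [det_scalar_sub_matrixZ_map] at hz
      by_contra! hlt
      have hne : z - μ ≠ 0 := by
        intro h0
        rw [sub_eq_zero.1 h0, Complex.norm_real, Real.norm_of_nonneg (by linarith)] at hlt
        exact lt_irrefl _ hlt
      have hc : (((μ - γ) * (μ * (μ - 2) - 1) : ℝ) : ℂ) = ((2 * (μ - 2) : ℝ) : ℂ) := by rw [h]
      push_cast at hc
      -- Dividing out the root `μ` leaves a quadratic whose coefficients are too small for a root of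
      -- modulus above `2.5`.
      have hq : z ^ 2 = ((2 + γ - μ : ℝ) : ℂ) * z + ((3 - 2 * γ + μ * (2 + γ - μ) : ℝ) : ℂ) := by
        refine mul_left_cancel₀ hne ?_
        push_cast
        linear_combination hz - hc
      have hn : ‖z‖ ^ 2 ≤ 0.85 * ‖z‖ + 1.9 := by
        rw [← norm_pow, hq]
        refine (norm_add_le _ _).trans (add_le_add ?_ ?_)
        · rw [norm_mul, Complex.norm_real]
          gcongr
          rw [Real.norm_eq_abs, abs_le]
          constructor <;> linarith
        · rw [Complex.norm_real, Real.norm_eq_abs, abs_le]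
          constructor <;> nlinarith
      nlinarith

theorem matrixSpectralRadius_matrixW_eq_iff {μ δ : ℝ} (hμ : μ ∈ Set.Ioo (2.2 : ℝ) 2.3)
    (hδ : δ ∈ Set.Ioo (-1.2 : ℝ) (-1.1)) :
    matrixSpectralRadius (matrixW δ) = μ ↔ (μ - δ) * (μ - 2) = 1 := by
  obtain ⟨hμ1, hμ2⟩ := hμ
  obtain ⟨hδ1, hδ2⟩ := hδ
  constructor
  · intro h
    have := det_eq_zero_of_matrixSpectralRadius_eq _ (matrixW_isSymm δ) μ h (by
      rw [det_scalar_sub_matrixW]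
      nlinarith)
    rw [det_scalar_sub_matrixW] at this
    linarith
  · intro h
    refine matrixSpectralRadius_eq_of_det _ μ (by linarith) ?_ fun z hz => ?_
    · rw [det_scalar_sub_matrixW_map]
      have : (((μ - δ) * (μ - 2) : ℝ) : ℂ) = ((1 : ℝ) : ℂ) := by rw [h]
      push_cast at this
      linear_combination this
    · rw [det_scalar_sub_matrixW_map] at hz
      by_contra! hlt
      have hne : z - μ ≠ 0 := by
        intro h0
        rw [sub_eq_zero.1 h0, Complex.norm_real, Real.norm_of_nonneg (by linarith)] at hlt
        exact lt_irrefl _ hlt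
      have hc : (((μ - δ) * (μ - 2) : ℝ) : ℂ) = ((1 : ℝ) : ℂ) := by rw [h]
      push_cast at hc
      have hq : z = ((2 + δ - μ : ℝ) : ℂ) := by
        refine mul_left_cancel₀ hne ?_
        push_cast
        linear_combination hz - hc
      rw [hq, Complex.norm_real, Real.norm_eq_abs] at hlt
      have : |2 + δ - μ| ≤ 2 := abs_le.2 ⟨by linarith, by linarith⟩
      linarith

/-! ### Numerical bounds, existence and uniqueness of `γ₀` and `δ₀`. -/

theorem cos_pi_div_seven_cubic :
    8 * Real.cos (Real.pi / 7) ^ 3 - 4 * Real.cos (Real.pi / 7) ^ 2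
      - 4 * Real.cos (Real.pi / 7) + 1 = 0 := by
  have hpos : 0 < Real.cos (Real.pi / 7) := by
    apply Real.cos_pos_of_mem_Ioo
    constructor <;> linarith [Real.pi_pos]
  have h : Real.cos (4 * (Real.pi / 7)) = -Real.cos (3 * (Real.pi / 7)) := by
    rw [← Real.cos_pi_sub]
    congr 1
    ring
  rw [show 4 * (Real.pi / 7) = 2 * (2 * (Real.pi / 7)) by ring, Real.cos_two_mul, Real.cos_two_mul,
    Real.cos_three_mul] at h
  refine mul_left_cancel₀ (show Real.cos (Real.pi / 7) + 1 ≠ 0 by linarith) ?_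
  linear_combination h

theorem cos_pi_div_seven_mem : Real.cos (Real.pi / 7) ∈ Set.Ioo (0.9009 : ℝ) 0.901 := by
  have h := cos_pi_div_seven_cubic
  -- This crude bound isolates the largest root of the cubic, in a range where the cubic is
  -- increasing.
  have hlow : 0.89 < Real.cos (Real.pi / 7) := by
    refine lt_of_lt_of_le ?_ Real.one_sub_sq_div_two_le_cos
    nlinarith [Real.pi_lt_d2, Real.pi_pos]
  have hup := Real.cos_le_one (Real.pi / 7)
  generalize Real.cos (Real.pi / 7) = c at *
  constructor
  · by_contra! hc
    have : 0 < 8 * (c ^ 2 + c * 0.9009 + 0.9009 ^ 2) - 4 * (c + 0.9009) - 4 := by nlinarith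
    nlinarith [mul_nonneg (sub_nonneg.2 hc) this.le]
  · by_contra! hc
    have : 0 < 8 * (c ^ 2 + c * 0.901 + 0.901 ^ 2) - 4 * (c + 0.901) - 4 := by nlinarith
    nlinarith [mul_nonneg (sub_nonneg.2 hc) this.le]

theorem two_sqrt_two_cos_pi_div_seven_mem :
    2 * √2 * Real.cos (Real.pi / 7) ∈ Set.Ioo (2.5480 : ℝ) 2.5485 := by
  obtain ⟨h1, h2⟩ := cos_pi_div_seven_mem
  have h3 : 1.4142 < √2 := Real.lt_sqrt_of_sq_lt (by norm_num)
  have h4 : √2 < 1.41422 := by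
    rw [Real.sqrt_lt' (by norm_num)]
    norm_num
  constructor <;> nlinarith

theorem two_sqrt_two_cos_pi_div_five_mem :
    2 * √2 * Real.cos (Real.pi / 5) ∈ Set.Ioo (2.288 : ℝ) 2.2885 := by
  rw [Real.cos_pi_div_five]
  have h3 : 1.4142 < √2 := Real.lt_sqrt_of_sq_lt (by norm_num)
  have h4 : √2 < 1.41422 := by
    rw [Real.sqrt_lt' (by norm_num)]
    norm_num
  have h5 : 2.236 < √5 := Real.lt_sqrt_of_sq_lt (by norm_num)
  have h6 : √5 < 2.2361 := by
    rw [Real.sqrt_lt' (by norm_num)]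
    norm_num
  constructor <;> nlinarith

/-- The characteristic equation is linear in `γ`, so its solution is explicit. -/
theorem existsUnique_matrixZ {μ : ℝ} (hμ : μ ∈ Set.Ioo (2.5480 : ℝ) 2.5485) :
    ∃! γ : ℝ, γ ∈ Set.Ioo (-0.25 : ℝ) (-0.2) ∧ matrixSpectralRadius (matrixZ γ) = μ := by
  have hμ' : μ ∈ Set.Ioo (2.5 : ℝ) 2.6 := ⟨by linarith [hμ.1], by linarith [hμ.2]⟩
  obtain ⟨h1, h2⟩ := hμ
  have hD : 0 < μ * (μ - 2) - 1 := by nlinarith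
  refine ⟨μ - 2 * (μ - 2) / (μ * (μ - 2) - 1), ?_, ?_⟩
  · have hmem : μ - 2 * (μ - 2) / (μ * (μ - 2) - 1) ∈ Set.Ioo (-0.25 : ℝ) (-0.2) := by
      constructor
      · rw [lt_sub_iff_add_lt, ← lt_sub_iff_add_lt', div_lt_iff₀ hD]
        nlinarith
      · rw [sub_lt_iff_lt_add, ← sub_lt_iff_lt_add', lt_div_iff₀ hD]
        nlinarith
    refine ⟨hmem, (matrixSpectralRadius_matrixZ_eq_iff hμ' hmem).2 ?_⟩
    field_simp
    ring
  · rintro γ ⟨hγ, h⟩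
    rw [matrixSpectralRadius_matrixZ_eq_iff hμ' hγ] at h
    rw [← h]
    field_simp
    ring

theorem existsUnique_matrixW {μ : ℝ} (hμ : μ ∈ Set.Ioo (2.288 : ℝ) 2.2885) :
    ∃! δ : ℝ, δ ∈ Set.Ioo (-1.2 : ℝ) (-1.1) ∧ matrixSpectralRadius (matrixW δ) = μ := by
  have hμ' : μ ∈ Set.Ioo (2.2 : ℝ) 2.3 := ⟨by linarith [hμ.1], by linarith [hμ.2]⟩
  obtain ⟨h1, h2⟩ := hμ
  have hD : 0 < μ - 2 := by linarith
  refine ⟨μ - 1 / (μ - 2), ?_, ?_⟩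
  · have hmem : μ - 1 / (μ - 2) ∈ Set.Ioo (-1.2 : ℝ) (-1.1) := by
      constructor
      · rw [lt_sub_iff_add_lt, ← lt_sub_iff_add_lt', div_lt_iff₀ hD]
        nlinarith
      · rw [sub_lt_iff_lt_add, ← sub_lt_iff_lt_add', lt_div_iff₀ hD]
        nlinarith
    refine ⟨hmem, (matrixSpectralRadius_matrixW_eq_iff hμ' hmem).2 ?_⟩
    field_simp
    ring
  · rintro δ ⟨hδ, h⟩
    rw [matrixSpectralRadius_matrixW_eq_iff hμ' hδ] at h
    rw [← h]
    field_simp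
    ring

/-! ### Trees hanging from the cycle and the level function. -/

namespace SimpleGraph

section Unicyclic

variable {V : Type*} {G : SimpleGraph V}

/-- In a forest, a vertex reachable from `r` has at most one neighbour that is no farther from `r`
than itself. -/
theorem IsAcyclic.eq_of_adj_of_dist_le {F : SimpleGraph V} (hF : F.IsAcyclic) {r v w₁ w₂ : V}
    (hv : F.Reachable r v) (h₁ : F.Adj v w₁) (h₂ : F.Adj v w₂)
    (hd₁ : F.dist r w₁ ≤ F.dist r v) (hd₂ : F.dist r w₂ ≤ F.dist r v) : w₁ = w₂ := by
  classical
  -- A shortest path to such a `w` avoids `v`, so it extends to a path to `v`; paths in a forest are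
  -- unique.
  have key : ∀ w, F.Adj v w → F.dist r w ≤ F.dist r v →
      ∃ p : F.Walk r v, p.IsPath ∧ p.penultimate = w := by
    intro w hvw hd
    obtain ⟨q, hq, hl⟩ := (hv.trans hvw.reachable).exists_path_of_dist
    have hvq : v ∉ q.support := by
      intro hmem
      have := q.length_takeUntil_lt_length hmem hvw.ne
      have := F.dist_le (q.takeUntil v hmem)
      omega
    exact ⟨q.concat hvw.symm, (Walk.concat_isPath_iff _).2 ⟨hq, hvq⟩, by simp⟩
  obtain ⟨p, hp, rfl⟩ := key w₁ h₁ hd₁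
  obtain ⟨q, hq, rfl⟩ := key w₂ h₂ hd₂
  have := (hF.subsingleton_path r v).elim ⟨p, hp⟩ ⟨q, hq⟩
  rw [Subtype.mk.injEq] at this
  rw [this]

variable {C : G.Subgraph}

/-- A surviving cycle would be a cycle of `G`, hence `C`, yet it lacks `e`. -/
theorem IsUnicyclic.isAcyclic_deleteEdges (hG : G.IsUnicyclic) (hC : G.IsCycleSubgraph C)
    {s : Set (Sym2 V)} {e : Sym2 V} (he : e ∈ C.edgeSet) (hs : e ∈ s) :
    (G.deleteEdges s).IsAcyclic := by
  intro v p hp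
  have hle : G.deleteEdges s ≤ G := deleteEdges_le s
  have hp' : (p.mapLe hle).IsCycle := hp.mapLe hle
  have hCeq : (p.mapLe hle).toSubgraph = C := hG.2.unique ⟨v, _, hp', rfl⟩ hC
  rw [← hCeq, Walk.mem_edges_toSubgraph, Walk.edges_mapLe_eq_edges] at he
  have := p.edges_subset_edgeSet he
  rw [edgeSet_deleteEdges] at this
  exact this.2 hs

theorem IsCycleSubgraph.edgeSet_nonempty (hC : G.IsCycleSubgraph C) : C.edgeSet.Nonempty := by
  obtain ⟨v, p, hp, rfl⟩ := hC
  exact ⟨_, (Walk.mem_edges_toSubgraph p).2 (p.mk_start_snd_mem_edges hp.not_nil)⟩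

theorem IsUnicyclic.isAcyclic_deleteEdges_edgeSet (hG : G.IsUnicyclic)
    (hC : G.IsCycleSubgraph C) : (G.deleteEdges C.edgeSet).IsAcyclic := by
  obtain ⟨e, he⟩ := hC.edgeSet_nonempty
  exact hG.isAcyclic_deleteEdges hC he he

/-- Distinct vertices of the cycle lie in distinct trees of the forest. -/
theorem IsUnicyclic.eq_of_reachable (hG : G.IsUnicyclic) (hC : G.IsCycleSubgraph C) {u v : V}
    (hu : u ∈ C.verts) (hv : v ∈ C.verts) (h : (G.deleteEdges C.edgeSet).Reachable u v) :
    u = v := by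
  classical
  by_contra hne
  obtain ⟨a, c, hc, rfl⟩ := id hC
  rw [Walk.mem_verts_toSubgraph] at hu hv
  have hc' : (c.rotate u hu).IsCycle := hc.rotate hu
  have hedges : ∀ e, e ∈ (c.rotate u hu).edges ↔ e ∈ c.toSubgraph.edgeSet := fun e => by
    rw [Walk.mem_edges_toSubgraph, (c.rotate_edges u hu).mem_iff]
  have hv' : v ∈ (c.rotate u hu).support := by
    rwa [Walk.mem_support_rotate_iff]
  -- The cycle, started at `u`, splits at `v` into two arcs. Deleting one edge `e` of the second arc
  -- leaves an acyclic graph containing both the first arc and the forest path `q`. They coincide,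
  -- but `q` uses no edge of the cycle.
  set d := c.rotate u hu with hd
  have hdisj := hc'.isTrail.disjoint_edges_takeUntil_dropUntil hv'
  have hq2 : ¬ (d.dropUntil v hv').Nil := fun hn => hne hn.eq.symm
  have he : s(v, (d.dropUntil v hv').snd) ∈ (d.dropUntil v hv').edges :=
    Walk.mk_start_snd_mem_edges hq2
  set e := s(v, (d.dropUntil v hv').snd) with hedef
  have heC : e ∈ c.toSubgraph.edgeSet := (hedges e).1 (d.edges_dropUntil_subset_edges hv' he)
  have hT := hG.isAcyclic_deleteEdges hC heC (Set.mem_singleton e)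
  have heq1 : e ∉ (d.takeUntil v hv').edges := fun h1 => hdisj h1 he
  have hP1 : ((d.takeUntil v hv').toDeleteEdge e heq1).IsPath :=
    Walk.IsPath.toDeleteEdges _ _ (hc'.isPath_takeUntil hv') _
  obtain ⟨q, hq⟩ := h.exists_isPath
  have hle : G.deleteEdges c.toSubgraph.edgeSet ≤ G.deleteEdges {e} :=
    deleteEdges_anti (Set.singleton_subset_iff.2 heC)
  have huniq := (hT.subsingleton_path u v).elim ⟨_, hP1⟩ ⟨q.mapLe hle, hq.mapLe hle⟩
  rw [Subtype.mk.injEq] at huniq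
  have hn1 : ¬ (d.takeUntil v hv').Nil := fun hn => hne hn.eq
  have hf := Walk.mk_start_snd_mem_edges hn1
  have hfC := (hedges _).1 (d.edges_takeUntil_subset_edges hv' hf)
  have hf' : s(u, (d.takeUntil v hv').snd) ∈ q.edges := by
    rw [← Walk.edges_mapLe_eq_edges hle q, ← huniq, Walk.toDeleteEdge, Walk.toDeleteEdges,
      Walk.edges_transfer]
    exact hf
  have := q.edges_subset_edgeSet hf'
  rw [edgeSet_deleteEdges] at this
  exact this.2 hfC

/-- On a walk towards the cycle, every edge before the first vertex of `C` has an end off `C` and so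
survives. -/
theorem IsCycleSubgraph.exists_reachable (hG : G.Connected) (hC : G.IsCycleSubgraph C) (v : V) :
    ∃ r ∈ C.verts, (G.deleteEdges C.edgeSet).Reachable r v := by
  obtain ⟨a, c, hc, rfl⟩ := hC
  obtain ⟨p⟩ := hG.preconnected v a
  have ha : a ∈ c.toSubgraph.verts := (Walk.mem_verts_toSubgraph c).2 c.start_mem_support
  clear hc
  generalize c.toSubgraph = C at *
  clear c
  induction p with
  | nil => exact ⟨_, ha, Reachable.refl _⟩
  | @cons u w _ h p ih =>
    by_cases hu : u ∈ C.verts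
    · exact ⟨u, hu, Reachable.refl _⟩
    · obtain ⟨r, hr, hrw⟩ := ih ha
      refine ⟨r, hr, hrw.trans (Adj.reachable ?_)⟩
      rw [deleteEdges_adj]
      exact ⟨h.symm, fun hC => hu (C.edge_vert (C.adj_symm (Subgraph.mem_edgeSet.1 hC)))⟩

theorem IsCycleSubgraph.ncard_neighborSet (hC : G.IsCycleSubgraph C) {v : V} (hv : v ∈ C.verts) :
    (C.neighborSet v).ncard = 2 := by
  obtain ⟨a, c, hc, rfl⟩ := hC
  exact hc.ncard_neighborSet_toSubgraph_eq_two ((Walk.mem_verts_toSubgraph c).1 hv)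

variable [Finite V]

theorem dist_lt_natCard (F : SimpleGraph V) (v w : V) : F.dist v w < Nat.card V := by
  classical
  have := Fintype.ofFinite V
  have : Nonempty V := ⟨v⟩
  by_cases h : F.Reachable v w
  · obtain ⟨p, hp, hl⟩ := h.exists_path_of_dist
    rw [← hl, Nat.card_eq_fintype_card]
    exact hp.length_lt
  · rw [dist_eq_zero_of_not_reachable h]
    exact Nat.card_pos

/-- In a forest, the distance from the root is at most the height of its tree. -/
theorem IsAcyclic.dist_le_rootedHeight {F : SimpleGraph V} (hF : F.IsAcyclic) {r v : V}
    (hv : F.Reachable r v) : F.dist r v ≤ F.rootedHeight r := by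
  -- A farthest vertex `u ≠ r` is pendant, since none of its neighbours is farther from `r`.
  obtain ⟨u, hu, hmax⟩ := Set.exists_max_image {w | F.Reachable r w} (fun w => F.dist r w)
    (Set.toFinite _) ⟨v, hv⟩
  refine (hmax v hv).trans ?_
  by_cases hur : r = u
  · subst hur
    simp
  -- The bound matters: `sSup` of an unbounded set of naturals is `0`.
  refine le_csSup ⟨Nat.card V, ?_⟩ ⟨u, hu, ?_, rfl⟩
  · rintro d ⟨w, -, -, rfl⟩
    exact (F.dist_lt_natCard r w).le
  · obtain ⟨p⟩ := hu.symm
    cases p with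
    | nil => exact absurd rfl hur
    | @cons _ w _ h p =>
      refine ⟨w, h, fun w' hw' => ?_⟩
      exact hF.eq_of_adj_of_dist_le hu hw' h (hmax _ (hu.trans hw'.reachable))
        (hmax _ (hu.trans h.reachable))

theorem IsCycleSubgraph.rootedHeight_lt_unicyclicHeight (hC : G.IsCycleSubgraph C) {r : V}
    (hr : r ∈ C.verts) : (G.deleteEdges C.edgeSet).rootedHeight r < G.unicyclicHeight := by
  refine Nat.lt_succ_of_le (le_csSup ⟨Nat.card V, ?_⟩ ⟨C, hC, r, hr, rfl⟩)
  rintro h ⟨C', -, v, -, rfl⟩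
  refine csSup_le' ?_
  rintro d ⟨w, -, -, rfl⟩
  exact (dist_lt_natCard _ v w).le

/-- The level function of a unicyclic graph: the distance from the cycle. -/
theorem IsUnicyclic.exists_level (hG : G.IsUnicyclic) :
    ∃ ℓ : V → ℕ, (∀ v, ℓ v < G.unicyclicHeight) ∧
      (∀ v, ℓ v = 0 → {w | G.Adj v w ∧ ℓ w = 0}.ncard ≤ 2) ∧
      (∀ v w, G.Adj v w → ℓ v ≤ ℓ w + 1) ∧
      ∀ v, ℓ v ≠ 0 → {w | G.Adj v w ∧ ℓ w ≤ ℓ v}.ncard ≤ 1 := by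
  obtain ⟨C, hC⟩ := hG.2.exists
  choose r hr hreach using hC.exists_reachable hG.1
  set F := G.deleteEdges C.edgeSet with hFdef
  have hF : F.IsAcyclic := hG.isAcyclic_deleteEdges_edgeSet hC
  -- Each tree contains only one cycle vertex, so a forest edge preserves the root.
  have hroot : ∀ v w, F.Adj v w → r v = r w := fun v w h =>
    hG.eq_of_reachable hC (hr v) (hr w)
      (((hreach v).trans h.reachable).trans (hreach w).symm)
  have hzero : ∀ v, F.dist (r v) v = 0 ↔ v ∈ C.verts := by
    intro v
    rw [(hreach v).dist_eq_zero_iff]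
    exact ⟨fun h => h ▸ hr v, fun h => hG.eq_of_reachable hC (hr v) h (hreach v)⟩
  have hadj : ∀ v w, G.Adj v w → C.Adj v w ∨ F.Adj v w := by
    intro v w h
    by_cases hc : C.Adj v w
    · exact Or.inl hc
    · exact Or.inr ((deleteEdges_adj).2 ⟨h, hc⟩)
  refine ⟨fun v => F.dist (r v) v, fun v => ?_, fun v hv => ?_, fun v w h => ?_, fun v hv => ?_⟩
  · exact (hF.dist_le_rootedHeight (hreach v)).trans_lt (hC.rootedHeight_lt_unicyclicHeight (hr v))
  · have hvC := (hzero v).1 hv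
    rw [← hC.ncard_neighborSet hvC]
    refine Set.ncard_le_ncard ?_ (Set.toFinite _)
    rintro w ⟨h, hw⟩
    refine (hadj v w h).resolve_right fun hFa => hFa.ne ?_
    exact hG.eq_of_reachable hC hvC ((hzero w).1 hw) hFa.reachable
  · rcases hadj v w h with hc | hFa
    · change F.dist (r v) v ≤ F.dist (r w) w + 1
      rw [(hzero v).2 (C.edge_vert hc)]
      exact Nat.zero_le _
    · change F.dist (r v) v ≤ F.dist (r w) w + 1
      rw [hroot v w hFa]
      have := (hreach w).dist_triangle_left v
      rwa [dist_eq_one_iff_adj.2 hFa.symm] at this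
  · rw [Set.ncard_le_one (Set.toFinite _)]
    have hFv : ∀ w, G.Adj v w → F.Adj v w := fun w h =>
      (hadj v w h).resolve_left fun hc => hv ((hzero v).2 (C.edge_vert hc))
    rintro a ⟨ha, hda⟩ b ⟨hb, hdb⟩
    have h1 := hroot v a (hFv a ha)
    have h2 := hroot v b (hFv b hb)
    change F.dist (r a) a ≤ F.dist (r v) v at hda
    change F.dist (r b) b ≤ F.dist (r v) v at hdb
    rw [← h1] at hda
    rw [← h2] at hdb
    exact hF.eq_of_adj_of_dist_le (hreach v) (hFv a ha) (hFv b hb) hda hdb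

end Unicyclic

end SimpleGraph

/-! ### Row inequalities for weights depending on the level. -/

theorem Finset.sum_le_of_card_filter_le {ι : Type*} (s : Finset ι) (P : ι → Prop)
    [DecidablePred P] (g : ι → ℝ) {a b : ℝ} (hb : 0 ≤ b) (hba : b ≤ a) {m n : ℕ}
    (ha : ∀ i ∈ s, g i ≤ a) (hg : ∀ i ∈ s, ¬ P i → g i ≤ b) (hm : (s.filter P).card ≤ m)
    (hs : s.card ≤ m + n) : ∑ i ∈ s, g i ≤ m * a + n * b := by
  have h1 : ∑ i ∈ s, g i ≤ ∑ i ∈ s, (b + if P i then a - b else 0) := by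
    refine Finset.sum_le_sum fun i hi => ?_
    split_ifs with h
    · linarith [ha i hi]
    · linarith [hg i hi h]
  rw [Finset.sum_add_distrib, Finset.sum_const, ← Finset.sum_filter, Finset.sum_const,
    nsmul_eq_mul, nsmul_eq_mul] at h1
  have h2 : ((s.filter P).card : ℝ) ≤ m := by exact_mod_cast hm
  have h3 : (s.card : ℝ) ≤ m + n := by exact_mod_cast hs
  nlinarith [mul_le_mul_of_nonneg_right h2 (sub_nonneg.2 hba), mul_le_mul_of_nonneg_right h3 hb]

namespace SimpleGraph

section AlphaMatrix

variable {V : Type*} [Fintype V] [DecidableEq V] {G : SimpleGraph V} [DecidableRel G.Adj]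

theorem sum_alphaMatrix_mul (α : ℝ) (x : V → ℝ) (v : V) :
    ∑ w, G.alphaMatrix α v w * x w =
      α * G.degree v * x v + (1 - α) * ∑ w ∈ G.neighborFinset v, x w := by
  have h : ∑ w, G.adjMatrix ℝ v w * x w = ∑ w ∈ G.neighborFinset v, x w := by
    simpa [Matrix.mulVec, dotProduct] using G.adjMatrix_mulVec_apply (α := ℝ) v x
  simp only [alphaMatrix, Matrix.add_apply, Matrix.smul_apply, smul_eq_mul, add_mul,
    Finset.sum_add_distrib, mul_assoc, ← Finset.mul_sum, h]
  simp [degMatrix, Matrix.diagonal_apply]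

theorem alphaMatrix_nonneg {α : ℝ} (hα : α ∈ Set.Ico (0 : ℝ) 1) (v w : V) :
    0 ≤ G.alphaMatrix α v w := by
  have h1 : 0 ≤ 1 - α := by linarith [hα.2]
  have h2 := hα.1
  simp only [alphaMatrix, Matrix.add_apply, Matrix.smul_apply, smul_eq_mul, degMatrix,
    Matrix.diagonal_apply, adjMatrix_apply]
  split_ifs <;> positivity

/-- Dividing the row inequality by `1 - α` turns each unit of degree missing from `3` into slack
`t`. -/
theorem matrixSpectralRadius_alphaMatrix_lt [Nonempty V] {α t μ : ℝ}
    (hα : α ∈ Set.Ico (0 : ℝ) 1) (ht : t * (1 - α) = α) (x : V → ℝ) (hx : ∀ v, 0 < x v)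
    (h : ∀ v, ∑ w ∈ G.neighborFinset v, x w < (μ + t * (3 - G.degree v)) * x v) :
    matrixSpectralRadius (G.alphaMatrix α) < α * 3 + (1 - α) * μ := by
  refine matrixSpectralRadius_lt_of_mulVec_lt _ (alphaMatrix_nonneg hα) x hx _ fun v => ?_
  rw [sum_alphaMatrix_mul]
  have := mul_lt_mul_of_pos_left (h v) (show 0 < 1 - α by linarith [hα.2])
  linear_combination this + (3 - G.degree v) * x v * ht

omit [DecidableEq V] in
theorem card_filter_neighborFinset (v : V) (P : V → Prop) [DecidablePred P] :
    ((G.neighborFinset v).filter P).card = {w | G.Adj v w ∧ P w}.ncard := by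
  rw [← Set.ncard_coe_finset]
  congr 1
  ext w
  simp

/-- Weights that depend only on the distance from the cycle bound the spectral radius. -/
theorem IsUnicyclic.matrixSpectralRadius_lt (hG : G.IsUnicyclic) (hΔ : G.maxDegree = 3)
    {α t μ : ℝ} (hα : α ∈ Set.Ico (0 : ℝ) 1) (ht : t * (1 - α) = α) (ht0 : 0 ≤ t)
    (f : ℕ → ℝ) (hf : ∀ j, 0 < f j) (hanti : Antitone f)
    (hbase : 2 * f 0 + f 1 < μ * f 0)
    (hmid : ∀ j, j + 2 < G.unicyclicHeight → f j + 2 * f (j + 2) < μ * f (j + 1))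
    (htop : ∀ j, j + 2 = G.unicyclicHeight → f j < (μ + 2 * t) * f (j + 1)) :
    matrixSpectralRadius (G.alphaMatrix α) < α * 3 + (1 - α) * μ := by
  have := hG.1.nonempty
  obtain ⟨ℓ, hlt, hzero, hstep, hup⟩ := hG.exists_level
  refine matrixSpectralRadius_alphaMatrix_lt hα ht (fun v => f (ℓ v)) (fun v => hf _) fun v => ?_
  have hdeg : G.degree v ≤ 3 := hΔ ▸ G.degree_le_maxDegree v
  have hdeg' : (G.degree v : ℝ) ≤ 3 := by exact_mod_cast hdeg
  have hcard : (G.neighborFinset v).card = G.degree v := G.card_neighborFinset_eq_degree v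
  have hpos := hf (ℓ v)
  have hslack : μ * f (ℓ v) ≤ (μ + t * (3 - G.degree v)) * f (ℓ v) := by
    have : 0 ≤ t * (3 - G.degree v) * f (ℓ v) := by
      have : 0 ≤ 3 - (G.degree v : ℝ) := by linarith
      positivity
    linarith
  rcases hj : ℓ v with _ | j
  · rw [hj] at hslack
    refine lt_of_le_of_lt ?_ (hbase.trans_le hslack)
    have := Finset.sum_le_of_card_filter_le (G.neighborFinset v) (fun w => ℓ w = 0)
      (fun w => f (ℓ w)) (hf 1).le (hanti zero_le_one) (m := 2) (n := 1)
      (fun w _ => hanti (Nat.zero_le _)) (fun w _ hw => hanti (Nat.one_le_iff_ne_zero.2 hw))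
      (by rw [card_filter_neighborFinset]; exact hzero v hj) (by omega)
    simpa using this
  · have hparent : ∀ w ∈ G.neighborFinset v, f (ℓ w) ≤ f j := fun w hw => by
      have := hstep v w ((G.mem_neighborFinset v w).1 hw)
      exact hanti (by omega)
    have hfilter : ((G.neighborFinset v).filter (fun w => ℓ w ≤ ℓ v)).card ≤ 1 := by
      rw [card_filter_neighborFinset]
      exact hup v (by omega)
    by_cases hlast : j + 2 < G.unicyclicHeight
    · rw [hj] at hslack
      refine lt_of_le_of_lt ?_ ((hmid j hlast).trans_le hslack)
      have := Finset.sum_le_of_card_filter_le (G.neighborFinset v) (fun w => ℓ w ≤ ℓ v)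
        (fun w => f (ℓ w)) (hf (j + 2)).le (hanti (show j ≤ j + 2 by omega)) (m := 1) (n := 2)
        hparent (fun w _ hw => hanti (by omega)) hfilter (by omega)
      simpa using this
    · have hj2 : j + 2 = G.unicyclicHeight := by
        have := hlt v
        omega
      have hall : ∀ w, ℓ w ≤ ℓ v := fun w => by
        have := hlt w
        omega
      -- On the last level every neighbour counts as a parent, and there is at most one; hence the
      -- slack `2 * t`.
      have hd1 : G.degree v ≤ 1 := by
        rwa [Finset.filter_true_of_mem fun w _ => hall w, hcard] at hfilter
      have hd1' : (G.degree v : ℝ) ≤ 1 := by exact_mod_cast hd1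
      have := Finset.sum_le_of_card_filter_le (G.neighborFinset v) (fun w => ℓ w ≤ ℓ v)
        (fun w => f (ℓ w)) le_rfl (hf j).le (m := 1) (n := 0)
        hparent (fun w _ hw => absurd (hall w) hw) hfilter (by omega)
      refine lt_of_le_of_lt (by simpa using this) ((htop j hj2).trans_le ?_)
      refine mul_le_mul_of_nonneg_right ?_ (hf _).le
      nlinarith

end AlphaMatrix

end SimpleGraph

/-! ### Choice of weights and conclusion. -/

theorem exists_weights_three {μ γ γ₀ : ℝ} (hμ : μ ∈ Set.Ioo (2.5480 : ℝ) 2.5485)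
    (hγ₀ : (μ - γ₀) * (μ * (μ - 2) - 1) = 2 * (μ - 2)) (hγ₀' : γ₀ < 0) (hγ : γ < γ₀) :
    ∃ a b : ℝ, 0 < b ∧ b ≤ a ∧ a ≤ 1 ∧ 2 + a < μ ∧ 1 + 2 * b < μ * a ∧ a < (μ - γ) * b := by
  obtain ⟨h1, h2⟩ := hμ
  have hg : 0 < μ - γ := by linarith
  have hD : 0 < μ * (μ - 2) - 1 := by nlinarith
  have hpos : 0 < μ - 2 / (μ - γ) := by
    rw [sub_pos, div_lt_iff₀ hg]
    nlinarith
  -- A suitable `b` lies between `a / (μ - γ)` and `(μ * a - 1) / 2`, which needs `a` above the left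
  -- side here. For `γ = γ₀` both sides are equal.
  have hlt : 1 / (μ - 2 / (μ - γ)) < μ - 2 := by
    rw [div_lt_iff₀ hpos]
    have : 2 * (μ - 2) / (μ - γ) < μ * (μ - 2) - 1 := by
      rw [div_lt_iff₀ hg]
      nlinarith
    linear_combination this
  obtain ⟨a, ha1, ha2⟩ := exists_between hlt
  have ha0 : 0 < a := (by positivity : 0 < 1 / (μ - 2 / (μ - γ))).trans ha1
  rw [div_lt_iff₀ hpos] at ha1
  have hlt' : a / (μ - γ) < (μ * a - 1) / 2 := by
    linear_combination ha1 / 2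
  obtain ⟨b, hb1, hb2⟩ := exists_between hlt'
  refine ⟨a, b, (by positivity : 0 < a / (μ - γ)).trans hb1, ?_, by linarith, by linarith,
    by linarith, ?_⟩
  · nlinarith
  · rw [div_lt_iff₀ hg] at hb1
    linarith

theorem exists_weight_two {μ δ δ₀ : ℝ} (hμ : μ ∈ Set.Ioo (2.288 : ℝ) 2.2885)
    (hδ₀ : (μ - δ₀) * (μ - 2) = 1) (hδ₀' : δ₀ < 0) (hδ : δ < δ₀) :
    ∃ a : ℝ, 0 < a ∧ a ≤ 1 ∧ 2 + a < μ ∧ 1 < (μ - δ) * a := by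
  obtain ⟨h1, h2⟩ := hμ
  have hd : 0 < μ - δ := by linarith
  have hlt : 1 / (μ - δ) < μ - 2 := by
    rw [div_lt_iff₀ hd]
    nlinarith
  obtain ⟨a, ha1, ha2⟩ := exists_between hlt
  refine ⟨a, (by positivity : 0 < 1 / (μ - δ)).trans ha1, by linarith, by linarith, ?_⟩
  rw [div_lt_iff₀ hd] at ha1
  linarith

/-- The condition on `α` says that `-2 * α / (1 - α) < γ`. -/
theorem neg_two_mul_div_lt {α γ : ℝ} (hα : α < 1) (hγ : γ < 0) (h : -γ / (2 - γ) < α) :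
    -(2 * (α / (1 - α))) < γ := by
  have h1 : 0 < 1 - α := by linarith
  rw [div_lt_iff₀ (by linarith)] at h
  have : -γ / 2 < α / (1 - α) := by
    rw [lt_div_iff₀ h1]
    linarith
  linarith

theorem mainTheorem8 :
    (∃! γ₀ : ℝ, γ₀ ∈ Set.Ioo (-0.25 : ℝ) (-0.2) ∧
      matrixSpectralRadius (matrixZ γ₀) = 2 * √2 * Real.cos (Real.pi / 7)) ∧
    (∃! δ₀ : ℝ, δ₀ ∈ Set.Ioo (-1.2 : ℝ) (-1.1) ∧
      matrixSpectralRadius (matrixW δ₀) = 2 * √2 * Real.cos (Real.pi / 5)) ∧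
    ∀ γ₀ δ₀ : ℝ,
      γ₀ ∈ Set.Ioo (-0.25 : ℝ) (-0.2) →
      matrixSpectralRadius (matrixZ γ₀) = 2 * √2 * Real.cos (Real.pi / 7) →
      δ₀ ∈ Set.Ioo (-1.2 : ℝ) (-1.1) →
      matrixSpectralRadius (matrixW δ₀) = 2 * √2 * Real.cos (Real.pi / 5) →
      ∀ (V : Type*) [Fintype V] [DecidableEq V] (G : SimpleGraph V) [DecidableRel G.Adj],
        G.IsUnicyclic → G.maxDegree = 3 →
        ∀ α : ℝ, α ∈ Set.Ico (0 : ℝ) 1 →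
          (G.unicyclicHeight = 3 ∧ α > -γ₀ / (2 - γ₀) ∨
            G.unicyclicHeight = 2 ∧ α > -δ₀ / (2 - δ₀)) →
          G.AlphaUpperBound α := by
  have hμ := two_sqrt_two_cos_pi_div_seven_mem
  have hν := two_sqrt_two_cos_pi_div_five_mem
  refine ⟨existsUnique_matrixZ hμ, existsUnique_matrixW hν, ?_⟩
  intro γ₀ δ₀ hγ₀ hZ hδ₀ hW V _ _ G _ hG hΔ α hα hk
  rw [matrixSpectralRadius_matrixZ_eq_iff ⟨by linarith [hμ.1], by linarith [hμ.2]⟩ hγ₀] at hZ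
  rw [matrixSpectralRadius_matrixW_eq_iff ⟨by linarith [hν.1], by linarith [hν.2]⟩ hδ₀] at hW
  have h1 : 0 < 1 - α := by linarith [hα.2]
  have ht0 : 0 ≤ α / (1 - α) := div_nonneg hα.1 h1.le
  have ht : α / (1 - α) * (1 - α) = α := div_mul_cancel₀ _ h1.ne'
  rw [SimpleGraph.AlphaUpperBound, hΔ]
  rcases hk with ⟨hk, h⟩ | ⟨hk, h⟩
  · have hγ₀' : γ₀ < 0 := by linarith [hγ₀.2]
    obtain ⟨a, b, hb, hba, ha, hbase, hmid, htop⟩ :=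
      exists_weights_three hμ hZ hγ₀' (neg_two_mul_div_lt hα.2 hγ₀' h)
    have := hG.matrixSpectralRadius_lt hΔ hα ht ht0
      -- No vertex has level above `2`; the constant tail only keeps the weights positive and
      -- antitone.
      (fun | 0 => 1 | 1 => a | _ => b)
      (fun | 0 => one_pos | 1 => hb.trans_le hba | _ + 2 => hb)
      (antitone_nat_of_succ_le fun | 0 => ha | 1 => hba | _ + 2 => le_rfl)
      (by simpa using hbase)
      (fun j hj => by
        obtain rfl : j = 0 := by omega
        exact hmid)
      (fun j hj => by
        obtain rfl : j = 1 := by omega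
        simpa using htop)
    rw [hk]
    convert this using 2
    · norm_num
    · norm_num
      ring
  · have hδ₀' : δ₀ < 0 := by linarith [hδ₀.2]
    obtain ⟨a, ha0, ha, hbase, htop⟩ :=
      exists_weight_two hν hW hδ₀' (neg_two_mul_div_lt hα.2 hδ₀' h)
    have := hG.matrixSpectralRadius_lt hΔ hα ht ht0
      (fun | 0 => 1 | _ => a)
      (fun | 0 => one_pos | _ + 1 => ha0)
      (antitone_nat_of_succ_le fun | 0 => ha | _ + 1 => le_rfl)
      (by simpa using hbase)
      (fun j hj => by omega)
      (fun j hj => by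
        obtain rfl : j = 0 := by omega
        simpa using htop)
    rw [hk]
    convert this using 2
    · norm_num
    · norm_num
      ring
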